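/- Let $r\ge 1$ and $n\ge 0$ be integers. The wreath product $\mathbb{Z}_r\wr S_n$ consists of the pairs $(\pi,\epsilon)$ with $\pi\in S_n$ and $\epsilon=(\omega^{c_1},\dots,\omega^{c_n})$, where $\omega=e^{2\pi i/r}$ and $c_j\in\{0,1,\dots,r-1\}$; put $\pi(0):=0$ and $c_0:=0$. Totally order colored letters by $j^{c}<k^{d}$ if $c>d$, or if $c=d$ and $j<k$. Define \[ \mathrm{Des}(\pi,\epsilon):=\{j\in\{0,\dots,n-1\}:\pi(j)^{c_j}>\pi(j+1)^{c_{j+1}}\},\qquad \mathrm{des}(\pi,\epsilon):=\#\mathrm{Des}(\pi,\epsilon), \] \[ \mathrm{Des}_A(\pi,\epsilon):=\{j\in\{1,\dots,n-1\}:\pi(j)^{c_j}>\pi(j+1)^{c_{j+1}}\},\qquad \mathrm{fmajor}(\pi,\epsilon):=r\sum_{j\in \mathrm{Des}_A(\pi,\epsilon)}j+\sum_{j=1}^n c_j , \] and $[m]_q:=1+q+\dots+q^{m-1}$. Then, as formal power series in $t$ with coefficients in $\mathbb{Z}[q]$ (in which the denominator below is invertible), \[ \sum_{k\ge 0}[rk+1]_q^n\,t^k=\frac{\sum_{(\pi,\epsilon)\in\mathbb{Z}_r\wr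 S_n}t^{\mathrm{des}(\pi,\epsilon)}q^{\mathrm{fmajor}(\pi,\epsilon)}}{\prod_{j=0}^n\left(1-tq^{rj}\right)} . \] -/

import Mathlib

open Polynomial PowerSeries

/-- An element of the wreath product `ℤ_r ≀ S_n`: a pair `(π, ε)` where `π` is a permutation of
`n` letters and `ε` is a vector of `n` powers of a primitive `r`-th root of unity `ω`. The vector
`ε` is recorded by its exponents `c`, where `ε_j = ω ^ c_j` and `c_j ∈ ℤ/r`. Positions and values
are indexed from `0` here, and shifted to `1, …, n` in `entry` and `colorAt` below. -/
@[ext]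
structure ColoredPerm (r n : ℕ) where
  perm : Equiv.Perm (Fin n)
  color : Fin n → ZMod r

namespace ColoredPerm

/-- A colored permutation is the same as a pair consisting of a permutation and a color vector. -/
def equivProd (r n : ℕ) : ColoredPerm r n ≃ Equiv.Perm (Fin n) × (Fin n → ZMod r) where
  toFun w := (w.perm, w.color)
  invFun p := ⟨p.1, p.2⟩
  left_inv _ := rfl
  right_inv _ := rfl

instance instFintype (r n : ℕ) [NeZero r] : Fintype (ColoredPerm r n) :=
  Fintype.ofEquiv _ (equivProd r n).symm

/-- The group structure of the wreath product: multiplication of the generalized permutation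
matrices that have the entry `ε_i` in position `(π(i), i)`. -/
instance instGroup (r n : ℕ) : Group (ColoredPerm r n) where
  mul w v := ⟨w.perm * v.perm, fun i => w.color (v.perm i) + v.color i⟩
  one := ⟨1, 0⟩
  inv w := ⟨w.perm⁻¹, fun i => -w.color (w.perm⁻¹ i)⟩
  mul_assoc a b c := ColoredPerm.ext rfl (funext fun _ => add_assoc _ _ _)
  one_mul a := ColoredPerm.ext rfl (funext fun _ => zero_add _)
  mul_one a := ColoredPerm.ext rfl (funext fun _ => add_zero _)
  inv_mul_cancel a := ColoredPerm.ext (inv_mul_cancel a.perm) (funext fun i => by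
    change -a.color (a.perm⁻¹ (a.perm i)) + a.color i = 0
    simp)

variable {r n : ℕ}

/-- The value `π(j) ∈ {1, …, n}` for `1 ≤ j ≤ n`, with the conventions `π(0) = 0` and
`π(n + 1) = n + 1`. -/
def entry (w : ColoredPerm r n) (j : ℕ) : ℕ :=
  if h : 1 ≤ j ∧ j ≤ n then (w.perm ⟨j - 1, by omega⟩ : ℕ) + 1 else j

/-- The color `c_j ∈ {0, …, r - 1}` for `1 ≤ j ≤ n`, with the conventions `c_0 = c_{n+1} = 0`
(that is, `ε_0 = ε_{n+1} = 1`). -/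
def colorAt (w : ColoredPerm r n) (j : ℕ) : ℕ :=
  if h : 1 ≤ j ∧ j ≤ n then (w.color ⟨j - 1, by omega⟩).val else 0

/-- The strict total order on colored letters `j^c`, written as pairs `(j, c)`:
`j^c < k^d` if `c > d`, or if `c = d` and `j < k`. -/
def LetterLT (a b : ℕ × ℕ) : Prop :=
  a.2 > b.2 ∨ (a.2 = b.2 ∧ a.1 < b.1)

instance instDecidableLetterLT (a b : ℕ × ℕ) : Decidable (LetterLT a b) :=
  inferInstanceAs (Decidable (a.2 > b.2 ∨ (a.2 = b.2 ∧ a.1 < b.1)))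

/-- `w` has a descent in position `j`, that is, `π(j)^{c_j} > π(j+1)^{c_{j+1}}`. -/
def HasDescentAt (w : ColoredPerm r n) (j : ℕ) : Prop :=
  LetterLT (w.entry (j + 1), w.colorAt (j + 1)) (w.entry j, w.colorAt j)

instance instDecidableHasDescentAt (w : ColoredPerm r n) (j : ℕ) :
    Decidable (w.HasDescentAt j) :=
  inferInstanceAs (Decidable (LetterLT _ _))

/-- The descent set `Des(π, ε) ⊆ {0, …, n - 1}`. -/
def descentSet (w : ColoredPerm r n) : Finset ℕ :=
  (Finset.range n).filter fun j => w.HasDescentAt j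

/-- The descent statistic `des(π, ε)`. -/
def des (w : ColoredPerm r n) : ℕ := w.descentSet.card

/-- The type-`A` descent set `Des_A(π, ε) ⊆ {1, …, n - 1}`. -/
def descentSetA (w : ColoredPerm r n) : Finset ℕ :=
  (Finset.Ico 1 n).filter fun j => w.HasDescentAt j

/-- The type-`A` major index, the sum of the type-`A` descents. -/
def majorA (w : ColoredPerm r n) : ℕ := ∑ j ∈ w.descentSetA, j

/-- The color sum `col(π, ε) = c_1 + ⋯ + c_n`. -/
def col (w : ColoredPerm r n) : ℕ := ∑ j ∈ Finset.Icc 1 n, w.colorAt j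

/-- The flag major index `fmajor = r · major_A + col`. -/
def fmajor (w : ColoredPerm r n) : ℕ := r * w.majorA + w.col

end ColoredPerm

/-- The `q`-integer `[m]_q = 1 + q + ⋯ + q^(m-1)`, a polynomial in the variable `q`. -/
noncomputable def qInt (m : ℕ) : ℤ[X] := ∑ i ∈ Finset.range m, (Polynomial.X : ℤ[X]) ^ i

/-- The denominator `∏_{j=0}^n (1 - t q^{rj})`, a power series in `t` over `ℤ[q]`. -/
noncomputable def carlitzDenominator (r n : ℕ) : ℤ[X]⟦X⟧ :=
  ∏ j ∈ Finset.range (n + 1),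
    (1 - (PowerSeries.X : ℤ[X]⟦X⟧) * PowerSeries.C ((Polynomial.X : ℤ[X]) ^ (r * j)))

/-- The numerator `∑_{(π, ε)} t^{des(π, ε)} q^{fmajor(π, ε)}`, a power series (in fact a
polynomial) in `t` over `ℤ[q]`. -/
noncomputable def eulerMahonianNumerator (r n : ℕ) [NeZero r] : ℤ[X]⟦X⟧ :=
  ∑ w : ColoredPerm r n,
    (PowerSeries.X : ℤ[X]⟦X⟧) ^ w.des * PowerSeries.C ((Polynomial.X : ℤ[X]) ^ w.fmajor)

/-!
The coefficient of `t ^ k` on the left is `∑ q ^ (f 1 + ⋯ + f n)` over all words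
`f : {1, …, n} → {0, …, r k}`. The identity comes from sorting such words, in the manner of
MacMahon and of Stanley's `P`-partitions.

Sort `f` weakly decreasingly, ties by increasing position. This gives a permutation `π`, and the
residues of `f (π j)` modulo `r` give colors `c j`, so that `f` determines a colored permutation
`w = (π, c)` (`ColoredPerm.standardization`) and the quotients `g j = f (π j) / r`. Since the letters
are ordered by decreasing color first and by increasing value second, `w` being the colored
permutation of `f` says exactly that `k ≥ g 1 ≥ ⋯ ≥ g n`, with strict inequality at each descent of
`w`; the descent in position `0` accounts for the bound `f ≤ r k`
(`ColoredPerm.standardization_ofQuotients_iff`).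

The words attached to a fixed `w` therefore contribute `q ^ col w` times a generating function of
chains with prescribed minimal drops `d 0, …, d (n-1)`. Splitting off the first term of the chain
shows by induction that this generating function, times `∏ (1 - t x ^ j)`, is the monomial
`t ^ (∑ d j) x ^ (∑ j d j)` (`mk_sum_droppingChains_mul_prod`). For `x = q ^ r` and `d` the indicator
of the descents, this is `t ^ des q ^ (r major_A)`.
-/

/-! ### Chains with prescribed drops -/

/-- The sequences `g 0, …, g (n-1)` of natural numbers such that in `k, g 0, …, g (n-1)` the `j`-th
step goes down by at least `d j`. The ambient box only makes this a `Finset`: all terms of such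
a sequence are at most `k`. -/
def droppingChains (n : ℕ) (d : Fin n → ℕ) (k : ℕ) : Finset (Fin n → ℕ) :=
  (Fintype.piFinset fun _ => Finset.range (k + 1)).filter fun g =>
    ∀ j : Fin n, g j + d j ≤ (Fin.cons k g : Fin (n + 1) → ℕ) j.castSucc

theorem mem_droppingChains {n : ℕ} {d : Fin n → ℕ} {k : ℕ} {g : Fin n → ℕ} :
    g ∈ droppingChains n d k ↔
      ∀ j : Fin n, g j + d j ≤ (Fin.cons k g : Fin (n + 1) → ℕ) j.castSucc := by
  simp only [droppingChains, Finset.mem_filter, Fintype.mem_piFinset, Finset.mem_range,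
    Nat.lt_succ_iff, and_iff_right_iff_imp]
  intro h
  have key : ∀ i : Fin (n + 1), (Fin.cons k g : Fin (n + 1) → ℕ) i ≤ k := by
    intro i
    induction i using Fin.induction with
    | zero => simp
    | succ i ih =>
      rw [Fin.cons_succ]
      exact (Nat.le_add_right _ _).trans ((h i).trans ih)
  exact fun j => by simpa using key j.succ

theorem cons_mem_droppingChains {n : ℕ} {d : Fin (n + 1) → ℕ} {k m : ℕ} {g : Fin n → ℕ} :
    (Fin.cons m g : Fin (n + 1) → ℕ) ∈ droppingChains (n + 1) d k ↔
      m + d 0 ≤ k ∧ g ∈ droppingChains n (Fin.tail d) m := by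
  simp only [mem_droppingChains, Fin.forall_fin_succ (n := n), Fin.castSucc_zero, Fin.cons_zero,
    Fin.cons_succ, ← Fin.succ_castSucc, Fin.tail]

section GeneratingFunction

variable {R : Type*} [CommRing R]

theorem sum_droppingChains_succ (n : ℕ) (d : Fin (n + 1) → ℕ) (k : ℕ) (x : R) :
    ∑ g ∈ droppingChains (n + 1) d k, x ^ ∑ j, g j =
      ∑ m ∈ Finset.range (k + 1), if m + d 0 ≤ k then
        x ^ m * ∑ g ∈ droppingChains n (Fin.tail d) m, x ^ ∑ j, g j else 0 := by
  rw [← Finset.sum_filter]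
  simp_rw [Finset.mul_sum]
  rw [Finset.sum_sigma']
  refine Finset.sum_bij' (fun g _ => (⟨g 0, Fin.tail g⟩ : Σ _ : ℕ, Fin n → ℕ))
    (fun p _ => (Fin.cons p.1 p.2 : Fin (n + 1) → ℕ)) ?_ ?_ ?_ ?_ ?_
  · intro g hg
    rw [← Fin.cons_self_tail g, cons_mem_droppingChains] at hg
    simp only [Finset.mem_sigma, Finset.mem_filter, Finset.mem_range]
    exact ⟨⟨by omega, hg.1⟩, hg.2⟩
  · rintro ⟨m, g⟩ hg
    simp only [Finset.mem_sigma, Finset.mem_filter] at hg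
    exact cons_mem_droppingChains.2 ⟨hg.1.2, hg.2⟩
  · intro g _
    exact Fin.cons_self_tail g
  · rintro ⟨m, g⟩ _
    simp
  · intro g _
    rw [Fin.sum_univ_succ, pow_add]
    rfl

theorem rescale_C (x a : R) :
    PowerSeries.rescale x (PowerSeries.C a) = PowerSeries.C a := by
  ext k
  rw [PowerSeries.coeff_rescale, PowerSeries.coeff_C]
  split_ifs with h <;> simp [h]

theorem mk_sum_range_succ_mul_one_sub_X (d : ℕ) (a : ℕ → R) :
    (PowerSeries.mk fun k => ∑ m ∈ Finset.range (k + 1), if m + d ≤ k then a m else 0) *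
        (1 - PowerSeries.X) = PowerSeries.X ^ d * PowerSeries.mk a := by
  ext k
  rw [mul_sub, mul_one, map_sub, PowerSeries.coeff_X_pow_mul']
  cases k with
  | zero =>
    rw [PowerSeries.coeff_zero_mul_X]
    rcases d with _ | d <;> simp
  | succ k =>
    rw [PowerSeries.coeff_succ_mul_X, PowerSeries.coeff_mk, PowerSeries.coeff_mk,
      PowerSeries.coeff_mk]
    -- The two partial sums differ in the term `m = k + 1 - d` only.
    have extend : ∑ m ∈ Finset.range (k + 1), (if m + d ≤ k then a m else 0) =
        ∑ m ∈ Finset.range (k + 1 + 1), (if m + d ≤ k then a m else 0) := by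
      rw [Finset.sum_range_succ _ (k + 1), if_neg (by omega), add_zero]
    rw [extend, ← Finset.sum_sub_distrib]
    have single : ∀ m ∈ Finset.range (k + 1 + 1),
        ((if m + d ≤ k + 1 then a m else 0) - if m + d ≤ k then a m else 0) =
          if m + d = k + 1 then a m else 0 := by
      intro m _
      by_cases h₁ : m + d ≤ k
      · rw [if_pos (by omega), if_pos h₁, if_neg (by omega), sub_self]
      · by_cases h₂ : m + d = k + 1
        · rw [if_pos (by omega), if_neg h₁, if_pos h₂, sub_zero]
        · rw [if_neg (by omega), if_neg h₁, if_neg h₂, sub_zero]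
    rw [Finset.sum_congr rfl single]
    by_cases hd : d ≤ k + 1
    · rw [if_pos hd, Finset.sum_eq_single (k + 1 - d)]
      · rw [if_pos (by omega)]
      · intro m _ hm
        rw [if_neg (by omega)]
      · intro h
        exact absurd (Finset.mem_range.2 (by omega)) h
    · rw [if_neg hd]
      exact Finset.sum_eq_zero fun m _ => if_neg (by omega)

/-- The generating function of chains with minimal drops `d`. After the first term `m` of a chain,
the rest is a chain below `m`; the weight `x ^ m` is absorbed by the substitution `t ↦ t x`,
which also shifts the factors of the denominator. -/
theorem mk_sum_droppingChains_mul_prod (n : ℕ) (d : Fin n → ℕ) (x : R) :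
    (PowerSeries.mk fun k => ∑ g ∈ droppingChains n d k, x ^ ∑ j, g j) *
        ∏ j ∈ Finset.range (n + 1), (1 - PowerSeries.X * PowerSeries.C (x ^ j)) =
      PowerSeries.X ^ (∑ j, d j) * PowerSeries.C (x ^ ∑ j : Fin n, (j : ℕ) * d j) := by
  induction n with
  | zero =>
    have one : ∀ k, ∑ g ∈ droppingChains 0 d k, x ^ ∑ j, g j = 1 := by
      intro k
      have : droppingChains 0 d k = Finset.univ := by
        ext g
        simp [mem_droppingChains, eq_iff_true_of_subsingleton]
      simp [this]
    simp only [one]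
    have h := mk_sum_range_succ_mul_one_sub_X (R := R) 0 (fun m => if m = 0 then 1 else 0)
    have h₁ : (PowerSeries.mk fun m : ℕ => if m = 0 then (1 : R) else 0) = 1 := by
      ext m
      simp [PowerSeries.coeff_one]
    rw [h₁] at h
    have h₂ : ∀ k : ℕ, (∑ m ∈ Finset.range (k + 1),
        if m + 0 ≤ k then (if m = 0 then (1 : R) else 0) else 0) = 1 := by
      intro k
      rw [Finset.sum_eq_single 0] <;> simp +contextual
    simp only [h₂] at h
    simpa using h
  | succ n ih =>
    have split := mk_sum_range_succ_mul_one_sub_X (d 0)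
      (fun m => x ^ m * ∑ g ∈ droppingChains n (Fin.tail d) m, x ^ ∑ j, g j)
    simp only [← sum_droppingChains_succ] at split
    rw [← PowerSeries.rescale_mk] at split
    have shift : ∏ j ∈ Finset.range (n + 1),
        ((1 : PowerSeries R) - PowerSeries.X * PowerSeries.C (x ^ (j + 1))) =
        PowerSeries.rescale x (∏ j ∈ Finset.range (n + 1),
          (1 - PowerSeries.X * PowerSeries.C (x ^ j))) := by
      rw [map_prod]
      refine Finset.prod_congr rfl fun j _ => ?_
      rw [map_sub, map_one, map_mul, PowerSeries.rescale_X, rescale_C, pow_succ,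
        map_mul]
      ring
    rw [Finset.prod_range_succ', pow_zero, map_one, mul_one, shift,
      mul_comm (PowerSeries.rescale x _), ← mul_assoc, split, mul_assoc, ← map_mul, ih (Fin.tail d)]
    rw [map_mul, map_pow, PowerSeries.rescale_X, rescale_C, Fin.sum_univ_succ d,
      Fin.sum_univ_succ (fun j : Fin (n + 1) => (j : ℕ) * d j)]
    simp only [Fin.val_zero, zero_mul, zero_add, Fin.val_succ, add_mul, one_mul,
      Finset.sum_add_distrib, Fin.tail, pow_add, map_mul, mul_pow, map_pow]
    ring

end GeneratingFunction

/-! ### Words and colored permutations -/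

/-- Sorting in decreasing order, with ties by increasing index, can be tested on neighbors. -/
theorem sort_toDual_eq_iff {m : ℕ} (f : Fin (m + 1) → ℕ) (σ : Equiv.Perm (Fin (m + 1))) :
    Tuple.sort (OrderDual.toDual ∘ f) = σ ↔ ∀ i : Fin m,
      f (σ i.succ) < f (σ i.castSucc) ∨
        f (σ i.succ) = f (σ i.castSucc) ∧ σ i.castSucc < σ i.succ := by
  rw [eq_comm, Tuple.eq_sort_iff', Fin.strictMono_iff_lt_succ]
  refine forall_congr' fun i => ?_
  rw [← Subtype.coe_lt_coe]
  change toLex (OrderDual.toDual (f (σ i.castSucc)), σ i.castSucc) <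
    toLex (OrderDual.toDual (f (σ i.succ)), σ i.succ) ↔ _
  rw [Prod.Lex.toLex_lt_toLex]
  simp [eq_comm]

namespace ColoredPerm

variable {r n : ℕ}

/-- The colored permutation of a word `f`: the permutation sorts `f` decreasingly, with ties by
increasing index, and the colors are the residues modulo `r` of the sorted word. -/
def standardization (r : ℕ) (f : Fin n → ℕ) : ColoredPerm r n where
  perm := Tuple.sort (OrderDual.toDual ∘ f)
  color j := (f (Tuple.sort (OrderDual.toDual ∘ f) j) : ZMod r)

/-- The word whose rearrangement by the permutation of `w` has the quotients `g` and the colors of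
`w` as residues modulo `r`. -/
def ofQuotients (w : ColoredPerm r n) (g : Fin n → ℕ) (i : Fin n) : ℕ :=
  r * g (w.perm.symm i) + (w.color (w.perm.symm i)).val

/-- The indicator of the descents of `w`, in positions `0, …, n - 1`. -/
def descentIndicator (w : ColoredPerm r n) (j : Fin n) : ℕ :=
  if w.HasDescentAt j then 1 else 0

theorem ofQuotients_perm (w : ColoredPerm r n) (g : Fin n → ℕ) (j : Fin n) :
    w.ofQuotients g (w.perm j) = r * g j + (w.color j).val := by
  simp [ofQuotients]

theorem entry_val_add_one (w : ColoredPerm r n) (j : Fin n) :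
    w.entry ((j : ℕ) + 1) = (w.perm j : ℕ) + 1 := by
  have h : 1 ≤ (j : ℕ) + 1 ∧ (j : ℕ) + 1 ≤ n := ⟨by omega, j.isLt⟩
  rw [entry, dif_pos h]
  simp

theorem colorAt_val_add_one (w : ColoredPerm r n) (j : Fin n) :
    w.colorAt ((j : ℕ) + 1) = (w.color j).val := by
  have h : 1 ≤ (j : ℕ) + 1 ∧ (j : ℕ) + 1 ≤ n := ⟨by omega, j.isLt⟩
  rw [colorAt, dif_pos h]
  simp

theorem hasDescentAt_zero_iff {m : ℕ} (w : ColoredPerm r (m + 1)) :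
    w.HasDescentAt 0 ↔ 0 < (w.color 0).val := by
  have h₁ := w.entry_val_add_one 0
  have h₂ := w.colorAt_val_add_one 0
  simp only [Fin.val_zero] at h₁ h₂
  rw [HasDescentAt, LetterLT, h₁, h₂]
  simp [entry, colorAt]

theorem hasDescentAt_succ_iff {m : ℕ} (w : ColoredPerm r (m + 1)) (i : Fin m) :
    w.HasDescentAt ((i : ℕ) + 1) ↔ (w.color i.castSucc).val < (w.color i.succ).val ∨
      (w.color i.castSucc).val = (w.color i.succ).val ∧
        w.perm i.succ < w.perm i.castSucc := by
  have h₁ := w.entry_val_add_one i.succ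
  have h₂ := w.colorAt_val_add_one i.succ
  have h₃ := w.entry_val_add_one i.castSucc
  have h₄ := w.colorAt_val_add_one i.castSucc
  simp only [Fin.val_succ, Fin.val_castSucc] at h₁ h₂ h₃ h₄
  rw [HasDescentAt, LetterLT, h₁, h₂, h₃, h₄, Fin.lt_def]
  simp only [gt_iff_lt, add_lt_add_iff_right]
  rw [eq_comm (a := (w.color i.succ).val)]

/-- Every word is recovered from its colored permutation and the quotients of its sorted
rearrangement. -/
theorem ofQuotients_div (f : Fin n → ℕ) :
    (standardization r f).ofQuotients (fun j => f ((standardization r f).perm j) / r) = f := by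
  funext i
  obtain ⟨j, rfl⟩ := (standardization r f).perm.surjective i
  rw [ofQuotients_perm]
  change r * _ + ((f ((standardization r f).perm j) : ℕ) : ZMod r).val = _
  rw [ZMod.val_natCast, Nat.div_add_mod]

theorem standardization_ofQuotients_eq_iff [NeZero r] (w : ColoredPerm r n) (g : Fin n → ℕ) :
    standardization r (w.ofQuotients g) = w ↔
      Tuple.sort (OrderDual.toDual ∘ w.ofQuotients g) = w.perm := by
  refine ⟨fun h => congrArg perm h, fun h => ColoredPerm.ext h (funext fun j => ?_)⟩
  simp only [standardization]
  rw [h, ofQuotients_perm]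
  simp

/-- The words bounded by `r * k` with colored permutation `w` are given by the chains
`k ≥ g 0 ≥ ⋯ ≥ g (n-1)` that are strict at the descents of `w`. -/
theorem standardization_ofQuotients_iff [NeZero r] (w : ColoredPerm r n) (g : Fin n → ℕ) (k : ℕ) :
    (∀ i, w.ofQuotients g i ≤ r * k) ∧ standardization r (w.ofQuotients g) = w ↔
      g ∈ droppingChains n w.descentIndicator k := by
  cases n with
  | zero =>
    simp [mem_droppingChains, standardization_ofQuotients_eq_iff, eq_iff_true_of_subsingleton]
  | succ m =>
    have hr : 0 < r := NeZero.pos r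
    -- Euclidean division turns the order of `r a + c` into the lexicographic order of `(a, c)`.
    have lex_lt : ∀ {a b c d : ℕ}, c < r → d < r →
        (r * a + c < r * b + d ↔ a < b ∨ a = b ∧ c < d) := by
      intro a b c d hc hd
      rcases lt_trichotomy a b with h | h | h
      · have := Nat.mul_le_mul_left r (Nat.succ_le_of_lt h)
        rw [Nat.mul_succ] at this
        exact ⟨fun _ => Or.inl h, fun _ => by omega⟩
      · subst h
        simp
      · have := Nat.mul_le_mul_left r (Nat.succ_le_of_lt h)
        rw [Nat.mul_succ] at this
        exact ⟨fun _ => by omega, fun _ => by omega⟩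
    have step : ∀ i : Fin m,
        (w.ofQuotients g (w.perm i.succ) < w.ofQuotients g (w.perm i.castSucc) ∨
          w.ofQuotients g (w.perm i.succ) = w.ofQuotients g (w.perm i.castSucc) ∧
            w.perm i.castSucc < w.perm i.succ) ↔
        g i.succ + w.descentIndicator i.succ ≤ g i.castSucc := by
      intro i
      have hne : w.perm i.castSucc ≠ w.perm i.succ :=
        fun h => (Fin.castSucc_lt_succ (i := i)).ne (w.perm.injective h)
      have hc := ZMod.val_lt (w.color i.castSucc)
      have hd := ZMod.val_lt (w.color i.succ)
      have h₁ := lex_lt (a := g i.succ) (b := g i.castSucc) hd hc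
      have h₂ := lex_lt (a := g i.castSucc) (b := g i.succ) hc hd
      have h₃ := w.hasDescentAt_succ_iff i
      rw [ofQuotients_perm, ofQuotients_perm, descentIndicator, Fin.val_succ]
      split_ifs with h <;> grind
    have sorted : standardization r (w.ofQuotients g) = w ↔
        ∀ i : Fin m, g i.succ + w.descentIndicator i.succ ≤ g i.castSucc := by
      rw [standardization_ofQuotients_eq_iff, sort_toDual_eq_iff]
      exact forall_congr' step
    have first : w.ofQuotients g (w.perm 0) ≤ r * k ↔ g 0 + w.descentIndicator 0 ≤ k := by
      have h := lex_lt (a := k) (b := g 0) hr (ZMod.val_lt (w.color 0))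
      have h₃ := w.hasDescentAt_zero_iff
      rw [ofQuotients_perm, descentIndicator, Fin.val_zero]
      split_ifs with h' <;> grind
    have bounded : standardization r (w.ofQuotients g) = w →
        ((∀ i, w.ofQuotients g i ≤ r * k) ↔ w.ofQuotients g (w.perm 0) ≤ r * k) := by
      intro h
      refine ⟨fun h' => h' _, fun h' i => ?_⟩
      have anti := Tuple.monotone_sort (OrderDual.toDual ∘ w.ofQuotients g)
      rw [(standardization_ofQuotients_eq_iff w g).1 h] at anti
      obtain ⟨j, rfl⟩ := w.perm.surjective i
      exact le_trans (OrderDual.toDual_le_toDual.1 (anti (Fin.zero_le j))) h'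
    rw [and_congr_left bounded, first, sorted, mem_droppingChains,
      Fin.forall_fin_succ (n := m)]
    simp only [Fin.castSucc_zero, Fin.cons_zero, ← Fin.succ_castSucc, Fin.cons_succ]

/-! ### Statistics and weights -/

theorem sum_descentIndicator (w : ColoredPerm r n) : ∑ j, w.descentIndicator j = w.des := by
  rw [des, descentSet, Finset.card_filter, Finset.sum_range]
  rfl

theorem sum_mul_descentIndicator (w : ColoredPerm r n) :
    ∑ j : Fin n, (j : ℕ) * w.descentIndicator j = w.majorA := by
  simp only [descentIndicator]
  rw [← Finset.sum_range (fun j => j * if w.HasDescentAt j then 1 else 0), majorA, descentSetA,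
    Finset.sum_filter]
  simp only [mul_ite, mul_one, mul_zero]
  cases n with
  | zero => simp
  | succ m =>
    -- Position `0` contributes nothing to the sum of the descents.
    rw [Finset.range_eq_Ico, Finset.sum_eq_sum_Ico_succ_bot (Nat.succ_pos m)]
    simp

theorem sum_color_val (w : ColoredPerm r n) : ∑ j, (w.color j).val = w.col := by
  rw [col, ← Finset.Ico_add_one_right_eq_Icc, Finset.sum_Ico_eq_sum_range, Nat.add_sub_cancel,
    Finset.sum_range]
  refine Finset.sum_congr rfl fun j _ => ?_
  rw [add_comm, colorAt_val_add_one]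

theorem sum_ofQuotients (w : ColoredPerm r n) (g : Fin n → ℕ) :
    ∑ i, w.ofQuotients g i = r * ∑ j, g j + w.col := by
  rw [← Equiv.sum_comp w.perm]
  simp only [ofQuotients_perm]
  rw [Finset.sum_add_distrib, ← Finset.mul_sum, sum_color_val]

end ColoredPerm

open ColoredPerm in
/-- Expanding the power gives a sum over words, which is grouped by the colored permutation of
the word. -/
theorem qInt_pow_eq_sum_coloredPerm (r n k : ℕ) [NeZero r] :
    qInt (r * k + 1) ^ n = ∑ w : ColoredPerm r n, (Polynomial.X : ℤ[X]) ^ w.col *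
      ∑ g ∈ droppingChains n w.descentIndicator k, ((Polynomial.X : ℤ[X]) ^ r) ^ ∑ j, g j := by
  classical
  have words : qInt (r * k + 1) ^ n =
      ∑ f ∈ Fintype.piFinset fun _ : Fin n => Finset.range (r * k + 1),
        (Polynomial.X : ℤ[X]) ^ ∑ i, f i := by
    rw [qInt, Finset.sum_pow']
    simp only [Finset.prod_pow_eq_pow_sum]
  rw [words, ← Finset.sum_fiberwise _ (standardization r)]
  refine Finset.sum_congr rfl fun w _ => ?_
  rw [Finset.mul_sum]
  have mem_fiber : ∀ f : Fin n → ℕ, f ∈ (Fintype.piFinset fun _ : Fin n =>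
      Finset.range (r * k + 1)).filter (fun f => standardization r f = w) ↔
        (∀ i, f i ≤ r * k) ∧ standardization r f = w := by
    intro f
    simp
  symm
  refine Finset.sum_bij' (fun g _ => w.ofQuotients g) (fun f _ j => f (w.perm j) / r)
    ?_ ?_ ?_ ?_ ?_
  · intro g hg
    rw [mem_fiber]
    exact (standardization_ofQuotients_iff w g k).2 hg
  · intro f hf
    rw [mem_fiber] at hf
    obtain ⟨hf, rfl⟩ := hf
    rw [← standardization_ofQuotients_iff, ofQuotients_div]
    exact ⟨hf, rfl⟩
  · intro g _
    funext j
    rw [ofQuotients_perm, Nat.mul_add_div (NeZero.pos r), Nat.div_eq_of_lt (ZMod.val_lt _),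
      add_zero]
  · intro f hf
    obtain ⟨-, rfl⟩ := (mem_fiber f).1 hf
    exact ofQuotients_div f
  · intro g _
    rw [sum_ofQuotients, ← pow_mul, ← pow_add, add_comm]

theorem isUnit_carlitzDenominator (r n : ℕ) : IsUnit (carlitzDenominator r n) := by
  rw [PowerSeries.isUnit_iff_constantCoeff, carlitzDenominator, map_prod]
  simp

theorem mk_qInt_pow_mul_carlitzDenominator (r n : ℕ) [NeZero r] :
    (PowerSeries.mk fun k : ℕ => qInt (r * k + 1) ^ n) * carlitzDenominator r n =
      eulerMahonianNumerator r n := by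
  have series : (PowerSeries.mk fun k : ℕ => qInt (r * k + 1) ^ n) =
      ∑ w : ColoredPerm r n, PowerSeries.C ((Polynomial.X : ℤ[X]) ^ w.col) *
        PowerSeries.mk fun k => ∑ g ∈ droppingChains n w.descentIndicator k,
          ((Polynomial.X : ℤ[X]) ^ r) ^ ∑ j, g j := by
    ext1 k
    rw [PowerSeries.coeff_mk, qInt_pow_eq_sum_coloredPerm, map_sum]
    simp only [PowerSeries.coeff_C_mul, PowerSeries.coeff_mk]
  rw [series, Finset.sum_mul, eulerMahonianNumerator]
  refine Finset.sum_congr rfl fun w _ => ?_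
  have chains := mk_sum_droppingChains_mul_prod n w.descentIndicator ((Polynomial.X : ℤ[X]) ^ r)
  simp only [← pow_mul] at chains ⊢
  rw [carlitzDenominator, mul_assoc, chains, w.sum_descentIndicator, w.sum_mul_descentIndicator,
    mul_left_comm, ← map_mul, ← pow_add, ColoredPerm.fmajor, add_comm]

/-- In `ℤ[q]⟦t⟧` the denominator is invertible, so that the quotient on the right of the identity
`∑_{k ≥ 0} [rk+1]_q^n t^k = (∑ t^des q^fmajor) / ∏_{j=0}^n (1 - t q^{rj})` is a genuine one, and
the identity holds. -/
theorem theorem5p8 (r n : ℕ) [NeZero r] :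
    IsUnit (carlitzDenominator r n) ∧
      (PowerSeries.mk fun k : ℕ => qInt (r * k + 1) ^ n) =
        eulerMahonianNumerator r n * Ring.inverse (carlitzDenominator r n) := by
  refine ⟨isUnit_carlitzDenominator r n, ?_⟩
  rw [Ring.eq_mul_inverse_iff_mul_eq _ _ _ (isUnit_carlitzDenominator r n)]
  exact mk_qInt_pow_mul_carlitzDenominator r n
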